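/- Let $c\ge 1$, $m\ge 0$ and $s\ge 0$ be integers, let $\mathbf k$ be a field, and let $R_n=\mathbf k[x_{i,j} : 1\le i\le c,\ 1\le j\le n]$, with the action of the symmetric group $\mathrm{Sym}(n)$ given by $\sigma\cdot x_{i,j}=x_{i,\sigma(j)}$. Let $A_1,\dots,A_s\in\{0,1\}^{c\times m}$, and for $n\ge m$ let $\mathbf x^{A_l}=\prod_{i,j}x_{i,j}^{(A_l)_{i,j}}\in R_n$ and $$I_n=\langle \mathrm{Sym}(n)(\mathbf x^{A_1},\dots,\mathbf x^{A_s})\rangle\subseteq R_n ,$$ while $I_n=0$ for $n<m$. Let $I_n^\vee$ be the Alexander dual of $I_n$, i.e. the ideal generated by the squarefree monomials $\prod_{v\in S}x_v$ such that the prime ideal $\langle x_v : v\in S\rangle$ is an associated prime of $I_n$. By a minimal generator of a monomial ideal we mean a monomial in it that is not divisible by any other monomial in it. (1) There is a polynomial $p\in\mathbb Q[t]$ of degree at most $\binom{c}{\lfloor c/2\rfloor}-1$ (the zero polynomial being allowed) such that, for all sufficiently large $n$, the set of minimal generators of $I_n^\vee$ consists of exactly $p(n)$ $\mathrm{Sym}(n)$-orbits.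 (2) Suppose that no $A_l$ is the zero matrix (so that $I_n\ne R_n$ for $n\ge m$). Then there are a function $d$ and integers $a,b$ with $d(n)=an+b$ for all sufficiently large $n$, and a polynomial $q\in\mathbb Q[t]$, such that, for all sufficiently large $n$, the least degree of a minimal generator of $I_n^\vee$ is $d(n)$, and the set of minimal generators of $I_n^\vee$ of degree $d(n)$ consists of exactly $q(n)$ $\mathrm{Sym}(n)$-orbits. -/

import Mathlib

open MvPolynomial Filter

noncomputable section

namespace SymDual

/-- The polynomial ring `R_n = k[x_{i,j} | i ∈ [c], j ∈ [n]]`. -/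
abbrev PolyRing (k : Type*) [Field k] (c n : ℕ) : Type _ :=
  MvPolynomial (Fin c × Fin n) k

/-- The action of `τ ∈ Sym(n)` on `R_n`, given by `τ · x_{i,j} = x_{i,τ(j)}`. -/
def symAct {k : Type*} [Field k] {c n : ℕ} (τ : Equiv.Perm (Fin n)) :
    PolyRing k c n →ₐ[k] PolyRing k c n :=
  rename (fun p => (p.1, τ p.2))

/-- The squarefree monomial `x^A` of a 0-1-matrix `A` with `m` columns, as an element of `R_n`
for `n ≥ m` (that is, `A` is padded with `n - m` zero columns). -/
def matMonomial (k : Type*) [Field k] {c m n : ℕ} (h : m ≤ n)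
    (A : Matrix (Fin c) (Fin m) (Fin 2)) : PolyRing k c n :=
  ∏ i : Fin c, ∏ j : Fin m, X (i, Fin.castLE h j) ^ (A i j : ℕ)

/-- The chain generated by `x^{A_1}, …, x^{A_s}`: the ideal of `R_n` generated by the
`Sym(n)`-orbits of these monomials if `n ≥ m`, and the zero ideal if `n < m`. -/
def chainIdeal (k : Type*) [Field k] {c m s : ℕ}
    (A : Fin s → Matrix (Fin c) (Fin m) (Fin 2)) (n : ℕ) : Ideal (PolyRing k c n) :=
  if h : m ≤ n then
    Ideal.span {f | ∃ (i : Fin s) (τ : Equiv.Perm (Fin n)), f = symAct τ (matMonomial k h (A i))}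
  else ⊥

/-- The Alexander dual of a squarefree monomial ideal `I`: it is generated by the squarefree
monomials `∏_{v ∈ S} x_v` such that the prime ideal `⟨x_v | v ∈ S⟩` is associated to `I`. -/
def alexanderDual {k : Type*} [Field k] {V : Type*} (I : Ideal (MvPolynomial V k)) :
    Ideal (MvPolynomial V k) :=
  Ideal.span {f | ∃ S : Finset V,
    Ideal.span ((fun v => (X v : MvPolynomial V k)) '' (S : Set V)) ∈
      associatedPrimes (MvPolynomial V k) (MvPolynomial V k ⧸ I) ∧ f = ∏ v ∈ S, X v}

/-- The set `G(J)` of minimal generators of a monomial ideal `J`: the monomials in `J` that are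
not divisible by any other monomial in `J`. -/
def minGens {k : Type*} [Field k] {V : Type*} (J : Ideal (MvPolynomial V k)) :
    Set (MvPolynomial V k) :=
  {f | ∃ u : V →₀ ℕ, f = monomial u 1 ∧ f ∈ J ∧
    ∀ v : V →₀ ℕ, (monomial v 1 : MvPolynomial V k) ∈ J → v ≤ u → v = u}

/-- The `Sym(n)`-orbit of `f ∈ R_n`. -/
def symOrbit {k : Type*} [Field k] {c n : ℕ} (f : PolyRing k c n) : Set (PolyRing k c n) :=
  {g | ∃ τ : Equiv.Perm (Fin n), g = symAct τ f}

/-- The number of `Sym(n)`-orbits of elements of `G`. -/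
def numOrbits {k : Type*} [Field k] {c n : ℕ} (G : Set (PolyRing k c n)) : ℕ :=
  (symOrbit '' G).ncard

/-- The minimal generators of the Alexander dual of the `n`-th ideal of the chain. -/
def dualGens (k : Type*) [Field k] {c m s : ℕ}
    (A : Fin s → Matrix (Fin c) (Fin m) (Fin 2)) (n : ℕ) : Set (PolyRing k c n) :=
  minGens (alexanderDual (chainIdeal k A n))

end SymDual

end

/-! The minimal generators of the dual are the products over minimal vertex covers `S` of the
generating monomials (`minGens_alexanderDual`). Up to permuting columns, `S` is determined by the
multiplicities `N U` with which each `U ⊆ [c]` occurs as a column, so orbits are lattice points with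
`∑ U, N U = n`. A generator meets only `m` columns, so covering depends only on `min (N U) m`;
minimality replaces one column by a proper subset, so it depends only on `N` truncated at `m + 1`
(`isMinimalCoverType_truncate_iff`).

Truncation therefore cuts the admissible `N` into finitely many slices. In each, the coordinates at
the threshold are free above it and the others are fixed, so stars and bars counts a slice by a
polynomial of degree at most the number of free coordinates minus one. If two comparable sets `V ⊂
U` were both free, turning one column `U` into `V` would preserve the cover; hence the free sets
form an antichain and Sperner's theorem gives the degree bound.

For the second part, the degree is the linear weight `∑ U, U.card * N U`. On a slice its minimum is
affine in `n`, attained by putting all excess on the lightest free sets. Among finitely many affine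
functions one is eventually least, and its minimizers are again slices. -/

namespace SymDual

/-! ### Associated primes, vertex covers and the Alexander dual -/

section Dual

variable {k V : Type*} [Field k]

/-- The ideal generated by a set of variables. -/
noncomputable abbrev varIdeal (k : Type*) [Field k] {V : Type*} (S : Set V) :
    Ideal (MvPolynomial V k) :=
  Ideal.span ((fun v => (X v : MvPolynomial V k)) '' S)

theorem X_mem_varIdeal_iff {S : Set V} {v : V} :
    (X v : MvPolynomial V k) ∈ varIdeal k S ↔ v ∈ S := by
  classical
  rw [varIdeal, mem_ideal_span_X_image]
  constructor
  · intro h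
    obtain ⟨i, hi, hne⟩ := h (Finsupp.single v 1) (by simp [support_X])
    have : v = i := by
      by_contra hvi
      exact hne (by simp [hvi])
    exact this ▸ hi
  · intro hv m hm
    rw [support_X, Finset.mem_singleton] at hm
    exact ⟨v, hv, by simp [hm]⟩

theorem monomial_mem_varIdeal_iff {S : Set V} {u : V →₀ ℕ} :
    (monomial u 1 : MvPolynomial V k) ∈ varIdeal k S ↔ ∃ v ∈ S, u v ≠ 0 := by
  classical
  rw [varIdeal, mem_ideal_span_X_image]
  simp [support_monomial]

/-- The ideal is the kernel of the endomorphism that kills the variables in `S` and fixes the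
others, and the target is a domain. -/
theorem isPrime_varIdeal (S : Set V) : (varIdeal k S).IsPrime := by
  classical
  let φ : MvPolynomial V k →ₐ[k] MvPolynomial V k := aeval fun v => if v ∈ S then 0 else X v
  have hmk : (Ideal.Quotient.mkₐ k (varIdeal k S)).comp φ =
      Ideal.Quotient.mkₐ k (varIdeal k S) := by
    refine algHom_ext fun v => ?_
    by_cases hv : v ∈ S
    · have : (X v : MvPolynomial V k) ∈ varIdeal k S := X_mem_varIdeal_iff.2 hv
      simpa [φ, hv] using (Ideal.Quotient.eq_zero_iff_mem.2 this).symm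
    · simp [φ, hv]
  have : varIdeal k S = RingHom.ker φ := by
    refine le_antisymm ?_ fun p hp => ?_
    · rw [varIdeal, Ideal.span_le]
      rintro _ ⟨v, hv, rfl⟩
      simp [φ, hv]
    · have h := DFunLike.congr_fun hmk p
      rw [AlgHom.comp_apply, show φ p = 0 from hp, map_zero] at h
      exact Ideal.Quotient.eq_zero_iff_mem.1 h.symm
  rw [this]
  exact RingHom.ker_isPrime _

/-- A set of variables is a vertex cover of an ideal if it generates an ideal containing it. -/
def IsVertexCover (I : Ideal (MvPolynomial V k)) (S : Set V) : Prop :=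
  I ≤ varIdeal k S

theorem isVertexCover_span_monomial_iff {E : Set (V →₀ ℕ)} {S : Set V} :
    IsVertexCover (Ideal.span ((fun u => (monomial u 1 : MvPolynomial V k)) '' E)) S ↔
      ∀ u ∈ E, ∃ v ∈ S, u v ≠ 0 := by
  rw [IsVertexCover, Ideal.span_le]
  constructor
  · exact fun h u hu => monomial_mem_varIdeal_iff.1 (h ⟨u, hu, rfl⟩)
  · rintro h _ ⟨u, hu, rfl⟩
    exact monomial_mem_varIdeal_iff.2 (h u hu)

theorem isVertexCover_of_isPrime {E : Set (V →₀ ℕ)} {Q : Ideal (MvPolynomial V k)}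
    (hQ : Q.IsPrime) (h : Ideal.span ((fun u => (monomial u 1 : MvPolynomial V k)) '' E) ≤ Q) :
    IsVertexCover (Ideal.span ((fun u => (monomial u 1 : MvPolynomial V k)) '' E))
      {v | (X v : MvPolynomial V k) ∈ Q} := by
  rw [isVertexCover_span_monomial_iff]
  intro u hu
  have hm : (monomial u 1 : MvPolynomial V k) ∈ Q := h (Ideal.subset_span ⟨u, hu, rfl⟩)
  rw [monomial_eq, C_1, one_mul, Finsupp.prod, hQ.prod_mem_iff] at hm
  obtain ⟨v, hv, hvQ⟩ := hm
  exact ⟨v, hQ.mem_of_pow_mem _ hvQ, Finsupp.mem_support_iff.1 hv⟩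

theorem isVertexCover_of_mem_associatedPrimes {I : Ideal (MvPolynomial V k)} {S : Set V}
    (h : varIdeal k S ∈ associatedPrimes (MvPolynomial V k) (MvPolynomial V k ⧸ I)) :
    IsVertexCover I S := by
  have := IsAssociatedPrime.annihilator_le h
  rwa [Submodule.annihilator_top, Ideal.annihilator_quotient] at this

/-- The variables in a prime containing a monomial ideal form a cover, so a minimal cover yields a
minimal prime of `I`. Minimal primes of the annihilator are associated, the ring being Noetherian.
-/
theorem mem_associatedPrimes_of_minimal [Finite V] {E : Set (V →₀ ℕ)} {S : Set V}
    (h : Minimal (IsVertexCover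
      (Ideal.span ((fun u => (monomial u 1 : MvPolynomial V k)) '' E))) S) :
    varIdeal k S ∈ associatedPrimes (MvPolynomial V k) (MvPolynomial V k ⧸
      (Ideal.span ((fun u => (monomial u 1 : MvPolynomial V k)) '' E))) := by
  apply Module.associatedPrimes.minimalPrimes_annihilator_subset_associatedPrimes
  rw [Ideal.annihilator_quotient]
  refine ⟨⟨isPrime_varIdeal S, h.1⟩, ?_⟩
  rintro Q ⟨hQ, hIQ⟩ hQS
  have hsub := h.2 (isVertexCover_of_isPrime hQ hIQ)
    fun v hv => X_mem_varIdeal_iff.1 (hQS hv)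
  rw [Ideal.span_le]
  rintro _ ⟨v, hv, rfl⟩
  exact hsub hv

/-- The exponent vector of a squarefree monomial. -/
noncomputable def indicator (S : Finset V) : V →₀ ℕ := ∑ v ∈ S, Finsupp.single v 1

theorem indicator_apply [DecidableEq V] (S : Finset V) (v : V) :
    indicator S v = if v ∈ S then 1 else 0 := by
  simp [indicator, Finsupp.finsetSum_apply, Finsupp.single_apply]

theorem indicator_le_indicator {S T : Finset V} : indicator S ≤ indicator T ↔ S ⊆ T := by
  classical
  constructor
  · intro h v hv
    by_contra hvT
    simpa [indicator_apply, hv, hvT] using h v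
  · intro h v
    by_cases hv : v ∈ S
    · simp [indicator_apply, hv, h hv]
    · simp [indicator_apply, hv]

theorem indicator_injective : Function.Injective (indicator : Finset V → V →₀ ℕ) :=
  fun _ _ h => (indicator_le_indicator.1 h.le).antisymm (indicator_le_indicator.1 h.ge)

theorem prod_X_eq_monomial (S : Finset V) :
    (∏ v ∈ S, X v : MvPolynomial V k) = monomial (indicator S) 1 := by
  rw [indicator, monomial_sum_one]
  rfl

theorem prod_X_injective :
    Function.Injective fun S : Finset V => (∏ v ∈ S, X v : MvPolynomial V k) := by
  intro S T h
  simp only [prod_X_eq_monomial] at h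
  exact indicator_injective (monomial_left_injective one_ne_zero h)

theorem totalDegree_prod_X (S : Finset V) :
    (∏ v ∈ S, X v : MvPolynomial V k).totalDegree = S.card := by
  rw [prod_X_eq_monomial, totalDegree_monomial _ one_ne_zero, indicator]
  change Finsupp.degree _ = _
  simp

/-- Every associated prime generated by variables is a cover and so contains a minimal one. Embedded
primes could contribute only non-minimal generators, so they need not be excluded. -/
theorem minGens_alexanderDual [Finite V] (E : Set (V →₀ ℕ)) :
    minGens (alexanderDual (Ideal.span ((fun u => (monomial u 1 : MvPolynomial V k)) '' E))) =
      (fun S : Finset V => (∏ v ∈ S, X v : MvPolynomial V k)) ''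
        {S | Minimal (fun T : Finset V => IsVertexCover
          (Ideal.span ((fun u => (monomial u 1 : MvPolynomial V k)) '' E)) (T : Set V)) S} := by
  classical
  set I := Ideal.span ((fun u => (monomial u 1 : MvPolynomial V k)) '' E) with hI
  have hassoc : ∀ S : Finset V,
      Minimal (fun T : Finset V => IsVertexCover I (T : Set V)) S →
      varIdeal k (S : Set V) ∈ associatedPrimes (MvPolynomial V k) (MvPolynomial V k ⧸ I) := by
    intro S hS
    refine mem_associatedPrimes_of_minimal ⟨hS.1, fun T hT hTS => ?_⟩
    have hfin : T.Finite := S.finite_toSet.subset hTS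
    have := @hS.2 hfin.toFinset (by simpa using hT) (by simpa using hTS)
    simpa using this
  have hmem : ∀ u : V →₀ ℕ, (monomial u 1 : MvPolynomial V k) ∈ alexanderDual I ↔
      ∃ S : Finset V, varIdeal k (S : Set V) ∈
        associatedPrimes (MvPolynomial V k) (MvPolynomial V k ⧸ I) ∧ indicator S ≤ u := by
    intro u
    have : alexanderDual I = Ideal.span ((fun u => (monomial u 1 : MvPolynomial V k)) ''
        (indicator '' {S : Finset V | varIdeal k (S : Set V) ∈
          associatedPrimes (MvPolynomial V k) (MvPolynomial V k ⧸ I)})) := by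
      rw [alexanderDual]
      congr 1
      ext f
      constructor
      · rintro ⟨S, hS, rfl⟩
        exact ⟨_, ⟨S, hS, rfl⟩, (prod_X_eq_monomial S).symm⟩
      · rintro ⟨_, ⟨S, hS, rfl⟩, rfl⟩
        exact ⟨S, hS, (prod_X_eq_monomial S).symm⟩
    rw [this, mem_ideal_span_monomial_image]
    simp [support_monomial]
  have hmin : ∀ S : Finset V, IsVertexCover I (S : Set V) →
      ∃ T ⊆ S, Minimal (fun T : Finset V => IsVertexCover I (T : Set V)) T := by
    intro S hS
    exact exists_minimal_le_of_wellFoundedLT (fun T : Finset V => IsVertexCover I (T : Set V)) S hS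
  ext f
  constructor
  · rintro ⟨u, rfl, hu, huv⟩
    obtain ⟨S, hS, hSu⟩ := (hmem u).1 hu
    obtain ⟨T, hTS, hT⟩ := hmin S (isVertexCover_of_mem_associatedPrimes hS)
    have := huv (indicator T) ((hmem _).2 ⟨T, hassoc T hT, le_rfl⟩)
      ((indicator_le_indicator.2 hTS).trans hSu)
    exact ⟨T, hT, this ▸ prod_X_eq_monomial T⟩
  · rintro ⟨S, hS, rfl⟩
    dsimp only
    rw [prod_X_eq_monomial]
    refine ⟨indicator S, rfl, (hmem _).2 ⟨S, hassoc S hS, le_rfl⟩, ?_⟩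
    intro v hv hvS
    obtain ⟨T, hT, hTv⟩ := (hmem v).1 hv
    refine hvS.antisymm (le_trans (indicator_le_indicator.2 ?_) hTv)
    exact hS.2 (isVertexCover_of_mem_associatedPrimes hT)
      (indicator_le_indicator.1 (hTv.trans hvS))

end Dual

/-! ### Counting lattice points through truncation -/

section Counting

theorem exists_polynomial_choose (s r : ℕ) :
    ∃ p : Polynomial ℚ, p.natDegree ≤ r ∧
      ∀ᶠ n : ℕ in atTop, ((r + 1 + (n - s) - 1).choose (n - s) : ℚ) = p.eval (n : ℚ) := by
  -- With `a = n - s` the count is `(a + r).choose r = (a + 1) ⋯ (a + r) / r!`, a rising factorial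
  -- evaluated at `n + 1 - s`.
  refine ⟨Polynomial.C ((r.factorial : ℚ)⁻¹) *
    (ascPochhammer ℚ r).comp (Polynomial.X + Polynomial.C (1 - s : ℚ)), ?_, ?_⟩
  · refine (Polynomial.natDegree_C_mul_le _ _).trans ?_
    rw [Polynomial.natDegree_comp, ascPochhammer_natDegree, Polynomial.natDegree_X_add_C, mul_one]
  · filter_upwards [eventually_ge_atTop s] with n hn
    obtain ⟨a, rfl⟩ := Nat.exists_eq_add_of_le hn
    have h1 : r + 1 + (s + a - s) - 1 = a + r := by omega
    have h2 : s + a - s = a := by omega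
    have h3 : ((s + a : ℕ) : ℚ) + (1 - s) = ((a + 1 : ℕ) : ℚ) := by push_cast; ring
    rw [h1, h2, Polynomial.eval_mul, Polynomial.eval_comp, Polynomial.eval_C, Polynomial.eval_add,
      Polynomial.eval_X, Polynomial.eval_C, h3, ascPochhammer_nat_eq_natCast_ascFactorial,
      Nat.ascFactorial_eq_factorial_mul_choose, ← Nat.choose_symm_add]
    have : (r.factorial : ℚ) ≠ 0 := by exact_mod_cast r.factorial_ne_zero
    push_cast
    field_simp

theorem exists_polynomial_sum {ι : Type*} (s : Finset ι) (f : ι → ℕ → ℕ) (d : ℕ)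
    (h : ∀ i ∈ s, ∃ p : Polynomial ℚ, p.natDegree ≤ d ∧
      ∀ᶠ n : ℕ in atTop, (f i n : ℚ) = p.eval (n : ℚ)) :
    ∃ p : Polynomial ℚ, p.natDegree ≤ d ∧
      ∀ᶠ n : ℕ in atTop, ((∑ i ∈ s, f i n : ℕ) : ℚ) = p.eval (n : ℚ) := by
  choose! p hd hp using h
  refine ⟨∑ i ∈ s, p i, Polynomial.natDegree_sum_le_of_forall_le _ _ hd, ?_⟩
  have := (eventually_all_finset s).2 hp
  filter_upwards [this] with n hn
  rw [Polynomial.eval_finsetSum, Nat.cast_sum]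
  exact Finset.sum_congr rfl hn

variable {P : Type*} [Fintype P]

section Slices

variable [DecidableEq P]

/-- The functions with total `n` that agree with `g` outside `K` and dominate `g` on `K`. -/
def slice (g : P → ℕ) (K : Finset P) (n : ℕ) : Finset (P → ℕ) :=
  (Finset.piAntidiag Finset.univ n).filter fun N =>
    (∀ U ∈ K, g U ≤ N U) ∧ ∀ U ∉ K, N U = g U

theorem mem_slice {g : P → ℕ} {K : Finset P} {n : ℕ} {N : P → ℕ} :
    N ∈ slice g K n ↔ ∑ U, N U = n ∧ (∀ U ∈ K, g U ≤ N U) ∧ ∀ U ∉ K, N U = g U := by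
  simp [slice]

theorem card_slice {g : P → ℕ} {K : Finset P} {n : ℕ} (hn : ∑ U, g U ≤ n) :
    (slice g K n).card = (Finset.piAntidiag K (n - ∑ U, g U)).card := by
  refine Finset.card_bij' (fun N _ U => N U - g U) (fun e _ U => e U + g U) ?_ ?_ ?_ ?_
  · intro N hN
    obtain ⟨hs, hK, hKc⟩ := mem_slice.1 hN
    have hle : ∀ U, g U ≤ N U := fun U => by
      by_cases hU : U ∈ K
      · exact hK U hU
      · exact (hKc U hU).ge
    rw [Finset.mem_piAntidiag]
    refine ⟨?_, fun U hU => ?_⟩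
    · rw [Finset.sum_subset (Finset.subset_univ K) fun U _ hU => by simp [hKc U hU],
        Finset.sum_tsub_distrib _ fun U _ => hle U, hs]
    · by_contra h
      exact hU (by simp [hKc U h])
  · intro e he
    obtain ⟨hs, hK⟩ := Finset.mem_piAntidiag.1 he
    have hz : ∀ U ∉ K, e U = 0 := fun U hU => by
      by_contra h
      exact hU (hK U h)
    rw [mem_slice]
    refine ⟨?_, fun U _ => by omega, fun U hU => by rw [hz U hU, zero_add]⟩
    rw [Finset.sum_add_distrib, ← Finset.sum_subset (Finset.subset_univ K) fun U _ hU => hz U hU, hs]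
    omega
  · intro N hN
    obtain ⟨hs, hK, hKc⟩ := mem_slice.1 hN
    funext U
    by_cases hU : U ∈ K
    · exact Nat.sub_add_cancel (hK U hU)
    · simp [hKc U hU]
  · intro e he
    simp

theorem exists_polynomial_card_slice (g : P → ℕ) (K : Finset P) :
    ∃ p : Polynomial ℚ, p.natDegree ≤ K.card - 1 ∧
      ∀ᶠ n : ℕ in atTop, ((slice g K n).card : ℚ) = p.eval (n : ℚ) := by
  rcases K.eq_empty_or_nonempty with rfl | hK
  -- Without free coordinates the slice has the single total `∑ U, g U`, so it is empty for larger
  -- `n`.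
  · refine ⟨0, by simp, ?_⟩
    filter_upwards [eventually_gt_atTop (∑ U, g U)] with n hn
    rw [card_slice hn.le, Finset.piAntidiag_empty_of_ne_zero (by omega)]
    simp
  · obtain ⟨r, hr⟩ := Nat.exists_eq_add_of_lt hK.card_pos
    obtain ⟨p, hd, hp⟩ := exists_polynomial_choose (∑ U, g U) r
    refine ⟨p, by omega, ?_⟩
    filter_upwards [hp, eventually_ge_atTop (∑ U, g U)] with n hn hge
    have hcard : ∀ e : ℕ, (Finset.piAntidiag K e).card = (Finset.finsuppAntidiag K e).card := by
      simp [Finset.finsuppAntidiag]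
    rw [← hn, card_slice hge, hcard, Finset.card_finsuppAntidiag_nat_eq_choose, hr, zero_add]

end Slices

/-- The places where `N` reaches the threshold `M`. -/
def saturated (M : ℕ) (N : P → ℕ) : Finset P := Finset.univ.filter fun U => M ≤ N U

theorem mem_saturated {M : ℕ} {N : P → ℕ} {U : P} : U ∈ saturated M N ↔ M ≤ N U := by
  simp [saturated]

/-- The truncation of `N` at height `M`. -/
def truncate (M : ℕ) (N : P → ℕ) (U : P) : ℕ := min (N U) M

theorem truncate_mem [DecidableEq P] (M : ℕ) (N : P → ℕ) :
    truncate M N ∈ Fintype.piFinset fun _ : P => Finset.range (M + 1) := by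
  simp [truncate]

theorem saturated_truncate (M : ℕ) (N : P → ℕ) :
    saturated M (truncate M N) = saturated M N := by
  ext U
  simp [mem_saturated, truncate]

theorem truncate_eq_iff [DecidableEq P] {M : ℕ} {N g : P → ℕ}
    (hg : g ∈ Fintype.piFinset fun _ : P => Finset.range (M + 1)) :
    truncate M N = g ↔ (∀ U ∈ saturated M g, g U ≤ N U) ∧ ∀ U ∉ saturated M g, N U = g U := by
  simp only [Fintype.mem_piFinset, Finset.mem_range] at hg
  simp only [funext_iff, truncate, mem_saturated, ← forall_and]
  refine forall_congr' fun U => ?_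
  have := hg U
  omega

/-- Since `Q` is constant on fibres of truncation, its solutions are the disjoint union of the
slices over the finitely many truncated `g` satisfying `Q`. -/
theorem exists_polynomial_ncard [DecidableEq P] {Q : (P → ℕ) → Prop} {M D : ℕ}
    (hQ : ∀ N, Q (truncate M N) ↔ Q N) (hD : ∀ N, Q N → (saturated M N).card ≤ D) :
    ∃ p : Polynomial ℚ, p.natDegree ≤ D - 1 ∧
      ∀ᶠ n : ℕ in atTop, ({N : P → ℕ | ∑ U, N U = n ∧ Q N}.ncard : ℚ) = p.eval (n : ℚ) := by
  classical
  set G := (Fintype.piFinset fun _ : P => Finset.range (M + 1)).filter Q with hG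
  obtain ⟨p, hd, hp⟩ := exists_polynomial_sum G (fun g n => (slice g (saturated M g) n).card)
    (D - 1) (fun g hg => by
      obtain ⟨p, hd, hp⟩ := exists_polynomial_card_slice g (saturated M g)
      exact ⟨p, hd.trans (Nat.sub_le_sub_right (hD g (Finset.mem_filter.1 hg).2) 1), hp⟩)
  refine ⟨p, hd, ?_⟩
  filter_upwards [hp] with n hn
  rw [← hn]
  have hset : {N : P → ℕ | ∑ U, N U = n ∧ Q N} =
      ((Finset.piAntidiag Finset.univ n).filter Q : Finset (P → ℕ)) := by
    ext N
    simp
  rw [hset, Set.ncard_coe_finset, Finset.card_eq_sum_card_fiberwise (f := truncate M) (t := G)]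
  · congr 1
    refine Finset.sum_congr rfl fun g hg => congrArg _ ?_
    obtain ⟨hg1, hg2⟩ := Finset.mem_filter.1 hg
    ext N
    rw [Finset.mem_filter, Finset.mem_filter, mem_slice, truncate_eq_iff hg1,
      ← truncate_eq_iff hg1]
    simp only [Finset.mem_piAntidiag, Finset.mem_univ, implies_true, and_true]
    constructor
    · rintro ⟨⟨h1, -⟩, h2⟩
      exact ⟨h1, h2⟩
    · rintro ⟨h1, h2⟩
      exact ⟨⟨h1, (hQ N).1 (h2 ▸ hg2)⟩, h2⟩
  · intro N hN
    have := (Finset.mem_filter.1 hN).2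
    exact Finset.mem_filter.2 ⟨truncate_mem M N, (hQ N).2 this⟩

/-- Eventual order of affine functions is lexicographic order on (slope, intercept). -/
theorem exists_eventually_least_affine {ι : Type*} {G : Finset ι} (hG : G.Nonempty)
    (a b : ι → ℤ) :
    ∃ i ∈ G, ∀ j ∈ G, (a j = a i ∧ b j = b i) ∨
      ∀ᶠ n : ℕ in atTop, a i * n + b i < a j * n + b j := by
  obtain ⟨i, hi, hmin⟩ := G.exists_min_image (fun i => toLex (a i, b i)) hG
  refine ⟨i, hi, fun j hj => ?_⟩
  rcases (Prod.Lex.toLex_le_toLex.1 (hmin j hj)) with h | ⟨h1, h2⟩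
  · right
    -- Integer slopes that differ do so by at least one, so `n` beyond the intercept gap suffices.
    filter_upwards [eventually_gt_atTop (b i - b j).toNat] with n hn
    have h1 : b i - b j < n := by omega
    have h2 : (1 : ℤ) * n ≤ (a j - a i) * n :=
      mul_le_mul_of_nonneg_right (by simp only at h; omega) (by positivity)
    linarith
  · simp only at h1 h2
    rcases h2.lt_or_eq with h2 | h2
    · right
      refine Eventually.of_forall fun n => ?_
      rw [h1]
      omega
    · exact Or.inl ⟨h1.symm, h2.symm⟩

/-- The least weight of a place where `g` reaches the threshold `M`. -/
noncomputable def leastWeight (w : P → ℕ) (M : ℕ) (g : P → ℕ) : ℕ :=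
  sInf (w '' (saturated M g : Set P))

/-- The places of least weight where `g` reaches the threshold `M`. -/
noncomputable def lightest (w : P → ℕ) (M : ℕ) (g : P → ℕ) : Finset P :=
  (saturated M g).filter fun U => w U = leastWeight w M g

theorem lightest_nonempty {w : P → ℕ} {M : ℕ} {g : P → ℕ} (h : (saturated M g).Nonempty) :
    (lightest w M g).Nonempty := by
  obtain ⟨U, hU, hw⟩ := Nat.sInf_mem (s := w '' (saturated M g : Set P)) (by simpa using h)
  exact ⟨U, Finset.mem_filter.2 ⟨hU, hw⟩⟩

theorem leastWeight_le {w : P → ℕ} {M : ℕ} {g : P → ℕ} {U : P} (hU : U ∈ saturated M g) :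
    leastWeight w M g ≤ w U :=
  Nat.sInf_le ⟨U, hU, rfl⟩

/-- The least weight of a function with total `n` whose truncation at height `M` is `g`. -/
noncomputable def sliceWeight (w : P → ℕ) (M : ℕ) (g : P → ℕ) (n : ℕ) : ℕ :=
  ∑ U, w U * g U + leastWeight w M g * (n - ∑ U, g U)

/-- The excess `N - truncate M N` vanishes off the saturated places, and on them `w` is at least
`leastWeight`; so no truncated subtraction loses anything that counts. -/
theorem sum_weight_eq (w : P → ℕ) (M : ℕ) (N : P → ℕ) :
    ∑ U, w U * N U = sliceWeight w M (truncate M N) (∑ U, N U) +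
      ∑ U, (w U - leastWeight w M (truncate M N)) * (N U - truncate M N U) := by
  have hle : ∀ U, truncate M N U ≤ N U := fun U => min_le_left _ _
  rw [sliceWeight, ← Finset.sum_tsub_distrib _ fun U _ => hle U, Finset.mul_sum,
    ← Finset.sum_add_distrib, ← Finset.sum_add_distrib]
  refine Finset.sum_congr rfl fun U _ => ?_
  by_cases hU : U ∈ saturated M (truncate M N)
  · obtain ⟨e, he⟩ := Nat.exists_eq_add_of_le (leastWeight_le (w := w) hU)
    obtain ⟨f, hf⟩ := Nat.exists_eq_add_of_le (hle U)
    rw [hf, he]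
    simp only [add_tsub_cancel_left]
    ring
  · have : truncate M N U = N U := by
      rw [mem_saturated, truncate] at hU
      rw [truncate]
      omega
    simp [this]

theorem sliceWeight_le (w : P → ℕ) (M : ℕ) (N : P → ℕ) :
    sliceWeight w M (truncate M N) (∑ U, N U) ≤ ∑ U, w U * N U := by
  rw [sum_weight_eq w M N]
  exact Nat.le_add_right _ _

/-- The surplus in `sum_weight_eq` vanishes exactly when all excess sits on lightest places, so the
minimizers form a slice again. -/
theorem sum_weight_eq_sliceWeight_iff [DecidableEq P] {w : P → ℕ} {M n : ℕ} {g N : P → ℕ}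
    (hg : g ∈ Fintype.piFinset fun _ : P => Finset.range (M + 1)) :
    (∑ U, N U = n ∧ truncate M N = g ∧ ∑ U, w U * N U = sliceWeight w M g n) ↔
      N ∈ slice g (lightest w M g) n := by
  have key : ∀ N, truncate M N = g → (∑ U, w U * N U = sliceWeight w M g (∑ U, N U) ↔
      ∀ U ∉ lightest w M g, N U = g U) := by
    rintro N rfl
    rw [sum_weight_eq w M N, Nat.add_eq_left, Finset.sum_eq_zero_iff]
    refine forall_congr' fun U => ?_
    have hle : truncate M N U ≤ N U := min_le_left _ _
    simp only [Finset.mem_univ, forall_const, Nat.mul_eq_zero, lightest, Finset.mem_filter]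
    by_cases hU : U ∈ saturated M (truncate M N)
    · have := leastWeight_le (w := w) hU
      simp only [hU, true_and]
      omega
    · have : truncate M N U = N U := by
        rw [mem_saturated, truncate] at hU
        rw [truncate]
        omega
      simp [hU, this]
  have hsub : ∀ U ∈ lightest w M g, U ∈ saturated M g := fun U hU => (Finset.mem_filter.1 hU).1
  rw [mem_slice]
  constructor
  · rintro ⟨rfl, h1, h2⟩
    exact ⟨rfl, fun U hU => ((truncate_eq_iff hg).1 h1).1 U (hsub U hU), (key N h1).1 h2⟩
  · rintro ⟨rfl, h1, h2⟩
    have htr : truncate M N = g := by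
      refine (truncate_eq_iff hg).2 ⟨fun U _ => ?_, fun U hU => h2 U fun h => hU (hsub U h)⟩
      by_cases hU : U ∈ lightest w M g
      · exact h1 U hU
      · exact (h2 U hU).ge
    exact ⟨rfl, htr, (key N htr).2 h2⟩

theorem slice_nonempty [DecidableEq P] {g : P → ℕ} {K : Finset P} {n : ℕ} (hK : K.Nonempty)
    (hn : ∑ U, g U ≤ n) : (slice g K n).Nonempty := by
  obtain ⟨U, hU⟩ := hK
  refine ⟨fun W => g W + if W = U then n - ∑ U, g U else 0, mem_slice.2 ⟨?_, fun W _ => by simp, ?_⟩⟩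
  · rw [Finset.sum_add_distrib]
    simp
    omega
  · rintro W hW
    have : W ≠ U := fun h => hW (h ▸ hU)
    simp [this]

theorem saturated_nonempty {M : ℕ} {N : P → ℕ} (h : Fintype.card P * M < ∑ U, N U) :
    (saturated M N).Nonempty := by
  by_contra hne
  rw [Finset.not_nonempty_iff_eq_empty] at hne
  refine h.not_ge ((Finset.sum_le_card_nsmul Finset.univ N M fun U _ => ?_).trans (by simp))
  by_contra hU
  have : U ∈ saturated M N := mem_saturated.2 (by omega)
  simp [hne] at this

theorem exists_least_weight [DecidableEq P] {Q : (P → ℕ) → Prop} {M : ℕ} (w : P → ℕ)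
    (hQ : ∀ N, Q (truncate M N) ↔ Q N) (hex : ∀ n, ∃ N, ∑ U, N U = n ∧ Q N) :
    ∃ d : ℕ → ℕ, (∃ a b : ℤ, ∀ᶠ n : ℕ in atTop, (d n : ℤ) = a * n + b) ∧
      (∀ᶠ n : ℕ in atTop,
        IsLeast ((fun N : P → ℕ => ∑ U, w U * N U) '' {N | ∑ U, N U = n ∧ Q N}) (d n)) ∧
      ∃ q : Polynomial ℚ, ∀ᶠ n : ℕ in atTop,
        ({N : P → ℕ | (∑ U, N U = n ∧ Q N) ∧ ∑ U, w U * N U = d n}.ncard : ℚ) =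
          q.eval (n : ℚ) := by
  classical
  -- Truncations with no saturated place are excluded: they do not occur for large `n`, and
  -- `leastWeight` would be the default `sInf ∅ = 0` there.
  set G := (Fintype.piFinset fun _ : P => Finset.range (M + 1)).filter
    fun g => Q g ∧ (saturated M g).Nonempty with hG
  have hmemG : ∀ N, Q N → Fintype.card P * M < ∑ U, N U → truncate M N ∈ G := fun N hN h =>
    Finset.mem_filter.2 ⟨truncate_mem M N, (hQ N).2 hN, by
      rw [saturated_truncate]; exact saturated_nonempty h⟩
  have hGne : G.Nonempty := by
    obtain ⟨N, h1, h2⟩ := hex (Fintype.card P * M + 1)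
    exact ⟨_, hmemG N h2 (by omega)⟩
  set a : (P → ℕ) → ℤ := fun g => leastWeight w M g with ha
  set b : (P → ℕ) → ℤ := fun g => ∑ U, w U * g U - leastWeight w M g * ∑ U, g U with hb
  have haff : ∀ g n, ∑ U, g U ≤ n → (sliceWeight w M g n : ℤ) = a g * n + b g := by
    intro g n hn
    simp only [sliceWeight, ha, hb]
    push_cast [Nat.cast_sub hn]
    ring
  obtain ⟨g₀, hg₀, hmin⟩ := exists_eventually_least_affine hGne a b
  have hev : ∀ᶠ n : ℕ in atTop, ∀ g ∈ G, ∑ U, g U ≤ n ∧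
      ((a g = a g₀ ∧ b g = b g₀) ∨ a g₀ * n + b g₀ < a g * n + b g) := by
    refine (eventually_all_finset G).2 fun g hg => ?_
    rcases hmin g hg with h | h
    · filter_upwards [eventually_ge_atTop (∑ U, g U)] with n hn using ⟨hn, Or.inl h⟩
    · filter_upwards [eventually_ge_atTop (∑ U, g U), h] with n hn h using ⟨hn, Or.inr h⟩
  have heq : ∀ᶠ n : ℕ in atTop, Fintype.card P * M < n ∧ ∀ g ∈ G,
      sliceWeight w M g₀ n ≤ sliceWeight w M g n ∧
      (sliceWeight w M g n = sliceWeight w M g₀ n ↔ a g = a g₀ ∧ b g = b g₀) := by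
    filter_upwards [hev, eventually_gt_atTop (Fintype.card P * M)] with n hn hn'
    refine ⟨hn', fun g hg => ?_⟩
    have h0 := haff g₀ n (hn g₀ hg₀).1
    have h1 := haff g n (hn g hg).1
    rcases (hn g hg).2 with h | h
    · have : sliceWeight w M g n = sliceWeight w M g₀ n := by
        zify
        rw [h0, h1, h.1, h.2]
      exact ⟨this.ge, fun _ => h, fun _ => this⟩
    · have hlt : sliceWeight w M g₀ n < sliceWeight w M g n := by
        zify
        rwa [h0, h1]
      refine ⟨hlt.le, fun h => absurd h hlt.ne', fun h' => ?_⟩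
      rw [h'.1, h'.2] at h
      exact absurd h (lt_irrefl _)
  refine ⟨sliceWeight w M g₀, ⟨a g₀, b g₀, ?_⟩, ?_, ?_⟩
  · filter_upwards [eventually_ge_atTop (∑ U, g₀ U)] with n hn using haff g₀ n hn
  · filter_upwards [heq, eventually_ge_atTop (∑ U, g₀ U)] with n hn hn'
    constructor
    · obtain ⟨hg1, hg2, hg3⟩ := Finset.mem_filter.1 hg₀
      obtain ⟨N, hN⟩ := slice_nonempty (lightest_nonempty (w := w) hg3) hn'
      obtain ⟨h1, h2, h3⟩ := (sum_weight_eq_sliceWeight_iff hg1).2 hN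
      exact ⟨N, ⟨h1, (hQ N).1 (h2 ▸ hg2)⟩, h3⟩
    · rintro _ ⟨N, ⟨rfl, h2⟩, rfl⟩
      exact (hn.2 _ (hmemG N h2 hn.1)).1.trans (sliceWeight_le w M N)
  · obtain ⟨q, -, hq⟩ := exists_polynomial_sum (G.filter fun g => a g = a g₀ ∧ b g = b g₀)
      -- No degree is claimed for `q`, so the crude bound `Fintype.card P` serves.
      (fun g n => (slice g (lightest w M g) n).card) (Fintype.card P) (fun g _ => by
        obtain ⟨p, hd, hp⟩ := exists_polynomial_card_slice g (lightest w M g)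
        exact ⟨p, hd.trans ((Nat.sub_le _ _).trans (Finset.card_le_univ _)), hp⟩)
    refine ⟨q, ?_⟩
    filter_upwards [hq, heq] with n hqn hn
    rw [← hqn]
    have hset : {N : P → ℕ | (∑ U, N U = n ∧ Q N) ∧ ∑ U, w U * N U = sliceWeight w M g₀ n} =
        ((Finset.piAntidiag Finset.univ n).filter
          fun N => Q N ∧ ∑ U, w U * N U = sliceWeight w M g₀ n : Finset (P → ℕ)) := by
      ext N
      simp [and_assoc]
    rw [hset, Set.ncard_coe_finset, Finset.card_eq_sum_card_fiberwise (f := truncate M)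
      (t := G.filter fun g => a g = a g₀ ∧ b g = b g₀)]
    · congr 1
      refine Finset.sum_congr rfl fun g hg => congrArg _ ?_
      obtain ⟨hgG, hgab⟩ := Finset.mem_filter.1 hg
      obtain ⟨hg1, hg2, -⟩ := Finset.mem_filter.1 hgG
      have hgw := (hn.2 g hgG).2.2 hgab
      ext N
      rw [← sum_weight_eq_sliceWeight_iff hg1, hgw]
      simp only [Finset.mem_filter, Finset.mem_piAntidiag, Finset.mem_univ, implies_true, and_true]
      constructor
      · rintro ⟨⟨h1, -, h2⟩, h3⟩
        exact ⟨h1, h3, h2⟩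
      · rintro ⟨h1, h2, h3⟩
        exact ⟨⟨h1, (hQ N).1 (h2 ▸ hg2), h3⟩, h2⟩
    · intro N hN
      obtain ⟨h1, h2, h3⟩ : ∑ U, N U = n ∧ Q N ∧ ∑ U, w U * N U = sliceWeight w M g₀ n := by
        simpa using hN
      subst h1
      have hNG := hmemG N h2 hn.1
      refine Finset.mem_filter.2 ⟨hNG, (hn.2 _ hNG).2.1 ?_⟩
      exact le_antisymm (h3 ▸ sliceWeight_le w M N) (hn.2 _ hNG).1

end Counting

/-! ### Column multiplicities of minimal covers -/

section CoverTypes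

variable {c m s : ℕ}

/-- The multiplicities `N` with one occurrence of `U` turned into `V`. -/
def shift {P : Type*} [DecidableEq P] (N : P → ℕ) (U V : P) (W : P) : ℕ :=
  if W = U then N W - 1 else if W = V then N W + 1 else N W

theorem sum_mul_shift {P : Type*} [DecidableEq P] [Fintype P] (w N : P → ℕ) {U V : P}
    (hUV : V ≠ U) (hU : 0 < N U) :
    ∑ W, w W * shift N U V W + w U = ∑ W, w W * N W + w V := by
  have h1 : w U = ∑ W, if W = U then w W else 0 := by simp
  have h2 : w V = ∑ W, if W = V then w W else 0 := by simp
  rw [h1, h2, ← Finset.sum_add_distrib, ← Finset.sum_add_distrib]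
  refine Finset.sum_congr rfl fun W _ => ?_
  unfold shift
  by_cases hWU : W = U
  · subst hWU
    obtain ⟨e, he⟩ := Nat.exists_eq_add_of_lt hU
    simp [hUV.symm, he, mul_add]
  · by_cases hWV : W = V
    · simp [hWV, mul_add, hUV]
    · simp [hWU, hWV]

/-- `N` gives the multiplicities of the columns of a vertex cover. -/
def IsCoverType (A : Fin s → Matrix (Fin c) (Fin m) (Fin 2)) (N : Finset (Fin c) → ℕ) : Prop :=
  ∀ (l : Fin s) (f : Fin m → Finset (Fin c)),
    (∀ U, (Finset.univ.filter fun j => f j = U).card ≤ N U) → ∃ j, ∃ i ∈ f j, A l i j ≠ 0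

/-- `N` gives the multiplicities of the columns of a minimal vertex cover. -/
def IsMinimalCoverType (A : Fin s → Matrix (Fin c) (Fin m) (Fin 2))
    (N : Finset (Fin c) → ℕ) : Prop :=
  IsCoverType A N ∧ ∀ U V, V ⊂ U → 0 < N U → ¬ IsCoverType A (shift N U V)

variable {A : Fin s → Matrix (Fin c) (Fin m) (Fin 2)}

/-- A choice `f` of `m` columns repeats no set more than `m` times, so multiplicities beyond `m` are
invisible. -/
theorem IsCoverType.of_min_le {N N' : Finset (Fin c) → ℕ} (h : IsCoverType A N)
    (hle : ∀ U, min (N' U) m ≤ N U) : IsCoverType A N' := by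
  refine fun l f hf => h l f fun U => (le_min (hf U) ?_).trans (hle U)
  exact (Finset.card_le_univ _).trans (by simp)

/-- The threshold is `m + 1` rather than `m` because `shift` may lower a multiplicity by one, and
the result must still be known up to `m`. -/
theorem isMinimalCoverType_truncate_iff (N : Finset (Fin c) → ℕ) :
    IsMinimalCoverType A (truncate (m + 1) N) ↔ IsMinimalCoverType A N := by
  refine and_congr ⟨fun h => h.of_min_le fun U => ?_, fun h => h.of_min_le fun U => ?_⟩
    (forall_congr' fun U => forall_congr' fun V => forall_congr' fun _ =>
      imp_congr ?_ (not_congr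
        ⟨fun h => h.of_min_le fun W => ?_, fun h => h.of_min_le fun W => ?_⟩))
  · unfold truncate; omega
  · unfold truncate; omega
  · unfold truncate; omega
  · simp only [truncate, shift]; split_ifs <;> omega
  · simp only [truncate, shift]; split_ifs <;> omega

/-- For saturated `V ⊂ U`, replacing a `U` by `V` leaves at least `m` copies of each, so the cover
survives, against minimality. Sperner's theorem applies to the resulting antichain. -/
theorem IsMinimalCoverType.card_saturated_le {N : Finset (Fin c) → ℕ}
    (h : IsMinimalCoverType A N) : (saturated (m + 1) N).card ≤ c.choose (c / 2) := by
  have hanti : IsAntichain (· ⊆ ·) (SetLike.coe (saturated (m + 1) N)) := by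
    intro V hV U hU hne hsub
    have hV : m + 1 ≤ N V := mem_saturated.1 hV
    have hU : m + 1 ≤ N U := mem_saturated.1 hU
    refine h.2 U V (hsub.ssubset_of_ne hne) (by omega) (h.1.of_min_le fun W => ?_)
    unfold shift
    split_ifs with h1 h2
    · omega
    · subst h2; omega
    · omega
  simpa using hanti.sperner

/-- With all columns full, every nonzero `A l` is met, so covers exist; one of least total size is
minimal, as each `shift` to a proper subset lowers the size. -/
theorem exists_isMinimalCoverType (hA : ∀ l, A l ≠ 0) (n : ℕ) :
    ∃ N, ∑ U, N U = n ∧ IsMinimalCoverType A N := by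
  classical
  have hne : {N : Finset (Fin c) → ℕ | ∑ U, N U = n ∧ IsCoverType A N}.Nonempty := by
    refine ⟨fun U => if U = Finset.univ then n else 0, by simp, fun l f hf => ?_⟩
    obtain ⟨i, j, hij⟩ : ∃ i j, A l i j ≠ 0 := by
      by_contra! h
      exact hA l (by ext i j; simp [h i j])
    refine ⟨j, i, ?_, hij⟩
    have hpos : 0 < (Finset.univ.filter fun j' => f j' = f j).card :=
      Finset.card_pos.2 ⟨j, by simp⟩
    have : f j = Finset.univ := by
      by_contra hfj
      have := hf (f j)
      simp only [hfj, if_false] at this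
      omega
    simp [this]
  obtain ⟨N, ⟨hN, hcov⟩, hmin⟩ := (measure fun N : Finset (Fin c) → ℕ =>
    ∑ U, U.card * N U).wf.has_min _ hne
  refine ⟨N, hN, hcov, fun U V hVU hU hcov' => ?_⟩
  refine hmin (shift N U V) ⟨?_, hcov'⟩ ?_
  · have := sum_mul_shift (fun _ => 1) N hVU.ne hU
    simpa [hN] using this
  · have := sum_mul_shift Finset.card N hVU.ne hU
    have hlt := Finset.card_lt_card hVU
    change ∑ W, W.card * shift N U V W < ∑ W, W.card * N W
    omega

end CoverTypes

/-! ### Sets of variables as families of columns -/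

section Columns

variable {c n : ℕ}

/-- The columns of a set of variables. -/
def cols (S : Finset (Fin c × Fin n)) (j : Fin n) : Finset (Fin c) :=
  Finset.univ.filter fun i => (i, j) ∈ S

/-- The set of variables with given columns. -/
def ofCols (T : Fin n → Finset (Fin c)) : Finset (Fin c × Fin n) :=
  Finset.univ.filter fun p => p.1 ∈ T p.2

theorem mem_cols {S : Finset (Fin c × Fin n)} {i : Fin c} {j : Fin n} :
    i ∈ cols S j ↔ (i, j) ∈ S := by
  simp [cols]

theorem mem_ofCols {T : Fin n → Finset (Fin c)} {p : Fin c × Fin n} :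
    p ∈ ofCols T ↔ p.1 ∈ T p.2 := by
  simp [ofCols]

theorem cols_ofCols (T : Fin n → Finset (Fin c)) : cols (ofCols T) = T := by
  ext j i
  rw [mem_cols, mem_ofCols]

theorem ofCols_cols (S : Finset (Fin c × Fin n)) : ofCols (cols S) = S := by
  ext p
  rw [mem_ofCols, mem_cols]

theorem subset_iff_cols_subset {S S' : Finset (Fin c × Fin n)} :
    S ⊆ S' ↔ ∀ j, cols S j ⊆ cols S' j := by
  refine ⟨fun h j i hi => mem_cols.2 (h (mem_cols.1 hi)), fun h p hp => ?_⟩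
  exact mem_cols.1 (h p.2 (mem_cols.2 hp))

/-- The multiplicity of `U` among the values of `T`. -/
def colCount {ι P : Type*} [Fintype ι] [DecidableEq P] (T : ι → P) (U : P) : ℕ :=
  (Finset.univ.filter fun j => T j = U).card

theorem sum_mul_colCount {ι P : Type*} [Fintype ι] [Fintype P] [DecidableEq P] (w : P → ℕ)
    (T : ι → P) : ∑ U, w U * colCount T U = ∑ j, w (T j) := by
  rw [← Finset.sum_fiberwise Finset.univ T]
  refine Finset.sum_congr rfl fun U _ => ?_
  rw [Finset.sum_congr rfl fun j hj => by rw [(Finset.mem_filter.1 hj).2], Finset.sum_const,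
    smul_eq_mul, mul_comm, colCount]

theorem sum_colCount {P : Type*} [Fintype P] [DecidableEq P] (T : Fin n → P) :
    ∑ U, colCount T U = n := by
  simpa using sum_mul_colCount (fun _ => 1) T

theorem card_eq_sum_colCount (S : Finset (Fin c × Fin n)) :
    S.card = ∑ U, U.card * colCount (cols S) U := by
  rw [sum_mul_colCount, Finset.card_eq_sum_card_fiberwise (f := Prod.snd) (t := Finset.univ)
    fun _ _ => Finset.mem_coe.2 (Finset.mem_univ _)]
  refine Finset.sum_congr rfl fun j _ => ?_
  refine Finset.card_bij' (fun p _ => p.1) (fun i _ => (i, j)) ?_ ?_ ?_ ?_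
  · rintro ⟨i, j'⟩ hp
    obtain ⟨h1, rfl⟩ := Finset.mem_filter.1 hp
    exact mem_cols.2 h1
  · intro i hi
    exact Finset.mem_filter.2 ⟨mem_cols.1 hi, rfl⟩
  · rintro ⟨i, j'⟩ hp
    obtain ⟨h1, rfl⟩ := Finset.mem_filter.1 hp
    rfl
  · intro i hi
    rfl

theorem exists_colCount_eq {P : Type*} [Fintype P] [DecidableEq P] {N : P → ℕ}
    (hN : ∑ U, N U = n) : ∃ T : Fin n → P, colCount T = N := by
  have hcard : Fintype.card (Σ U, Fin (N U)) = n := by simp [hN]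
  let e : Fin n ≃ Σ U, Fin (N U) := (Fintype.equivFinOfCardEq hcard).symm
  refine ⟨fun j => (e j).1, funext fun U => ?_⟩
  rw [colCount, ← Fintype.card_subtype]
  let e' : {j // (e j).1 = U} ≃ Fin (N U) :=
    (e.subtypeEquiv fun _ => Iff.rfl).trans
      (Equiv.sigmaSubtype (β := fun U => Fin (N U)) U)
  rw [Fintype.card_congr e', Fintype.card_fin]

theorem colCount_comp_equiv {ι κ P : Type*} [Fintype ι] [Fintype κ] [DecidableEq P]
    (T : κ → P) (e : ι ≃ κ) : colCount (fun j => T (e j)) = colCount T := by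
  funext U
  rw [colCount, colCount, ← Fintype.card_subtype, ← Fintype.card_subtype]
  exact Fintype.card_congr (e.subtypeEquiv fun _ => Iff.rfl)

theorem exists_perm_of_colCount_eq {ι P : Type*} [Fintype ι] [DecidableEq P] {T T' : ι → P}
    (h : colCount T = colCount T') : ∃ τ : Equiv.Perm ι, ∀ j, T' (τ j) = T j := by
  have e : ∀ U, Nonempty ({j // T j = U} ≃ {j // T' j = U}) := fun U => by
    refine ⟨Fintype.equivOfCardEq ?_⟩
    rw [Fintype.card_subtype, Fintype.card_subtype]
    exact congrFun h U
  exact ⟨Equiv.ofFiberEquiv fun U => (e U).some, Equiv.ofFiberEquiv_map _⟩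

/-- Embed each fibre of `f` into the corresponding fibre of `T` and glue; images of distinct fibres
are disjoint since `T` separates them. -/
theorem exists_injective_of_colCount_le {ι κ P : Type*} [Fintype ι] [Fintype κ] [DecidableEq P]
    {f : ι → P} {T : κ → P} (h : ∀ U, colCount f U ≤ colCount T U) :
    ∃ σ : ι → κ, Function.Injective σ ∧ ∀ j, T (σ j) = f j := by
  have e : ∀ U, Nonempty ({j // f j = U} ↪ {j // T j = U}) := fun U => by
    refine Function.Embedding.nonempty_of_card_le ?_
    rw [Fintype.card_subtype, Fintype.card_subtype]
    exact h U
  have hT : ∀ j, T ((e (f j)).some ⟨j, rfl⟩ : κ) = f j := fun j => ((e (f j)).some ⟨j, rfl⟩).2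
  refine ⟨fun j => ((e (f j)).some ⟨j, rfl⟩ : κ), fun j j' hjj => ?_, hT⟩
  have hf : f j = f j' := by
    rw [← hT j, ← hT j']
    exact congrArg T hjj
  have key : ∀ U (x y : {j // f j = U}),
      ((e U).some x : κ) = (e U).some y → (x : ι) = y := fun U x y hxy =>
    congrArg Subtype.val ((e U).some.injective (Subtype.ext hxy))
  have hcast : ∀ U (hU : f j' = U),
      ((e (f j')).some ⟨j', rfl⟩ : κ) = (e U).some ⟨j', hU⟩ := by
    rintro _ rfl
    rfl
  exact key (f j) ⟨j, rfl⟩ ⟨j', hf.symm⟩ (hjj.trans (hcast _ hf.symm))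

theorem colCount_le_of_injective {ι κ P : Type*} [Fintype ι] [Fintype κ] [DecidableEq P]
    (T : κ → P) {σ : ι → κ} (hσ : Function.Injective σ) (U : P) :
    colCount (fun j => T (σ j)) U ≤ colCount T U :=
  Finset.card_le_card_of_injOn σ (fun j hj => by simpa using hj) hσ.injOn

theorem colCount_update {ι P : Type*} [Fintype ι] [DecidableEq ι] [DecidableEq P] (T : ι → P)
    (j : ι) {V : P} (hV : V ≠ T j) :
    colCount (Function.update T j V) = shift (colCount T) (T j) V := by
  funext W
  unfold shift colCount
  split_ifs with h1 h2
  · subst h1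
    have : (Finset.univ.filter fun i => Function.update T j V i = T j) =
        (Finset.univ.filter fun i => T i = T j).erase j := by
      ext i
      by_cases hi : i = j
      · subst hi; simp [hV]
      · simp [hi]
    rw [this, Finset.card_erase_of_mem (by simp)]
  · subst h2
    have : (Finset.univ.filter fun i => Function.update T j W i = W) =
        insert j (Finset.univ.filter fun i => T i = W) := by
      ext i
      by_cases hi : i = j
      · subst hi; simp
      · simp [hi]
    rw [this, Finset.card_insert_of_notMem (by simpa using hV.symm)]
  · congr 1
    ext i
    by_cases hi : i = j
    · subst hi; simp [Ne.symm h1, Ne.symm h2]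
    · simp [hi]

end Columns

/-! ### Orbits correspond to multiplicity functions -/

section Orbits

variable {k : Type*} [Field k] {c m n s : ℕ}

/-- The set of variables obtained from `S` by permuting the columns. -/
def permute (τ : Equiv.Perm (Fin n)) (S : Finset (Fin c × Fin n)) : Finset (Fin c × Fin n) :=
  S.map ((Equiv.refl (Fin c)).prodCongr τ).toEmbedding

theorem cols_permute (τ : Equiv.Perm (Fin n)) (S : Finset (Fin c × Fin n)) (j : Fin n) :
    cols (permute τ S) (τ j) = cols S j := by
  ext i
  simp [mem_cols, permute]

theorem symAct_prod_X (τ : Equiv.Perm (Fin n)) (S : Finset (Fin c × Fin n)) :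
    symAct τ (∏ v ∈ S, X v : PolyRing k c n) = ∏ v ∈ permute τ S, X v := by
  rw [permute, Finset.prod_map, map_prod]
  exact Finset.prod_congr rfl fun v _ => by simp [symAct, Prod.map]

theorem symAct_symAct (σ τ : Equiv.Perm (Fin n)) (f : PolyRing k c n) :
    symAct σ (symAct τ f) = symAct (σ * τ) f := by
  simp only [symAct, rename_rename]
  rfl

theorem mem_symOrbit_self (f : PolyRing k c n) : f ∈ symOrbit f := by
  refine ⟨1, ?_⟩
  change f = rename id f
  rw [rename_id_apply]

theorem symOrbit_symAct (τ : Equiv.Perm (Fin n)) (f : PolyRing k c n) :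
    symOrbit (symAct τ f) = symOrbit f := by
  ext g
  constructor
  · rintro ⟨σ, rfl⟩
    exact ⟨σ * τ, symAct_symAct σ τ f⟩
  · rintro ⟨σ, rfl⟩
    exact ⟨σ * τ⁻¹, by rw [symAct_symAct, inv_mul_cancel_right]⟩

theorem symOrbit_prod_X_eq_iff {S S' : Finset (Fin c × Fin n)} :
    symOrbit (∏ v ∈ S, X v : PolyRing k c n) = symOrbit (∏ v ∈ S', X v) ↔
      colCount (cols S) = colCount (cols S') := by
  constructor
  · intro h
    obtain ⟨τ, hτ⟩ : (∏ v ∈ S', X v : PolyRing k c n) ∈ symOrbit (∏ v ∈ S, X v) :=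
      h ▸ mem_symOrbit_self _
    rw [symAct_prod_X] at hτ
    have hS : S' = permute τ S := prod_X_injective hτ
    rw [hS, ← colCount_comp_equiv (cols (permute τ S)) τ]
    congr 1
    funext j
    exact (cols_permute τ S j).symm
  · intro h
    obtain ⟨τ, hτ⟩ := exists_perm_of_colCount_eq h
    have hS : S' = permute τ S := by
      rw [← ofCols_cols S', ← ofCols_cols (permute τ S)]
      congr 1
      funext j
      obtain ⟨j, rfl⟩ := τ.surjective j
      rw [hτ, cols_permute]
    rw [hS, ← symAct_prod_X, symOrbit_symAct]

theorem numOrbits_prod_X (R : (Finset (Fin c) → ℕ) → Prop) :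
    numOrbits ((fun S : Finset (Fin c × Fin n) => (∏ v ∈ S, X v : PolyRing k c n)) ''
      {S | R (colCount (cols S))}) =
      {N : Finset (Fin c) → ℕ | ∑ U, N U = n ∧ R N}.ncard := by
  have hex : ∀ N : Finset (Fin c) → ℕ, ∑ U, N U = n →
      ∃ S : Finset (Fin c × Fin n), colCount (cols S) = N := fun N hN => by
    obtain ⟨T, hT⟩ := exists_colCount_eq hN
    exact ⟨ofCols T, by rw [cols_ofCols, hT]⟩
  choose! S hS using hex
  have himage : symOrbit ''
      ((fun S : Finset (Fin c × Fin n) => (∏ v ∈ S, X v : PolyRing k c n)) ''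
        {S | R (colCount (cols S))}) =
      (fun N => symOrbit (∏ v ∈ S N, X v : PolyRing k c n)) ''
        {N : Finset (Fin c) → ℕ | ∑ U, N U = n ∧ R N} := by
    rw [Set.image_image]
    ext O
    constructor
    · rintro ⟨S', hS', rfl⟩
      have hsum := sum_colCount (cols S')
      exact ⟨colCount (cols S'), ⟨hsum, hS'⟩, symOrbit_prod_X_eq_iff.2 (hS _ hsum)⟩
    · rintro ⟨N, ⟨hN, hR⟩, rfl⟩
      refine ⟨S N, ?_, rfl⟩
      change R (colCount (cols (S N)))
      rwa [hS N hN]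
  rw [numOrbits, himage, Set.InjOn.ncard_image]
  rintro N ⟨hN, -⟩ N' ⟨hN', -⟩ h
  have := symOrbit_prod_X_eq_iff.1 h
  rwa [hS N hN, hS N' hN'] at this

end Orbits

/-! ### Minimal covers of the chain ideals -/

section Chain

variable {k : Type*} [Field k] {c m n s : ℕ}

/-- The exponent vector of the image of `x^A` under `τ`. -/
noncomputable def matExponent (h : m ≤ n) (A : Matrix (Fin c) (Fin m) (Fin 2))
    (τ : Equiv.Perm (Fin n)) : Fin c × Fin n →₀ ℕ :=
  ∑ i, ∑ j, Finsupp.single (i, τ (Fin.castLE h j)) (A i j : ℕ)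

theorem symAct_matMonomial (h : m ≤ n) (A : Matrix (Fin c) (Fin m) (Fin 2))
    (τ : Equiv.Perm (Fin n)) :
    symAct τ (matMonomial k h A) = monomial (matExponent h A τ) 1 := by
  simp only [matMonomial, map_prod, map_pow, symAct, rename_X, matExponent, monomial_sum_one]
  simp only [X_pow_eq_monomial]

theorem matExponent_ne_zero_iff (h : m ≤ n) (A : Matrix (Fin c) (Fin m) (Fin 2))
    (τ : Equiv.Perm (Fin n)) (v : Fin c × Fin n) :
    matExponent h A τ v ≠ 0 ↔ ∃ i j, (i, τ (Fin.castLE h j)) = v ∧ A i j ≠ 0 := by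
  have hval : ∀ a : Fin 2, (a : ℕ) = 0 ↔ a = 0 := by decide
  simp only [matExponent, Finsupp.finsetSum_apply, Finsupp.single_apply, ne_eq,
    Finset.sum_eq_zero_iff, Finset.mem_univ, forall_const, ite_eq_right_iff, hval]
  push Not
  rfl

theorem chainIdeal_eq_span (A : Fin s → Matrix (Fin c) (Fin m) (Fin 2)) (h : m ≤ n) :
    chainIdeal k A n = Ideal.span ((fun u => (monomial u 1 : PolyRing k c n)) ''
      {u | ∃ l τ, u = matExponent h (A l) τ}) := by
  rw [chainIdeal, dif_pos h]
  congr 1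
  ext f
  constructor
  · rintro ⟨l, τ, rfl⟩
    exact ⟨_, ⟨l, τ, rfl⟩, (symAct_matMonomial h (A l) τ).symm⟩
  · rintro ⟨_, ⟨l, τ, rfl⟩, rfl⟩
    exact ⟨l, τ, (symAct_matMonomial h (A l) τ).symm⟩

theorem isVertexCover_chainIdeal_iff (A : Fin s → Matrix (Fin c) (Fin m) (Fin 2)) (h : m ≤ n)
    (S : Finset (Fin c × Fin n)) :
    IsVertexCover (chainIdeal k A n) (S : Set (Fin c × Fin n)) ↔
      IsCoverType A (colCount (cols S)) := by
  rw [chainIdeal_eq_span A h, isVertexCover_span_monomial_iff]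
  constructor
  · intro hS l f hf
    obtain ⟨σ, hσ, hσf⟩ := exists_injective_of_colCount_le hf
    -- An injective placement of the `m` columns extends to a permutation of `Fin n`, so it comes
    -- from an actual generator.
    obtain ⟨τ, hτ⟩ := Equiv.Perm.exists_extending_pair (Fin.castLE h) σ
      (Fin.castLE_injective h) hσ
    obtain ⟨v, hv, hne⟩ := hS _ ⟨l, τ, rfl⟩
    obtain ⟨i, j, rfl, hij⟩ := (matExponent_ne_zero_iff h (A l) τ v).1 hne
    refine ⟨j, i, ?_, hij⟩
    rw [← hσf, ← hτ]
    exact mem_cols.2 hv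
  · rintro hS _ ⟨l, τ, rfl⟩
    obtain ⟨j, i, hi, hij⟩ := hS l (fun j => cols S (τ (Fin.castLE h j)))
      (colCount_le_of_injective (cols S) (τ.injective.comp (Fin.castLE_injective h)))
    exact ⟨(i, τ (Fin.castLE h j)), mem_cols.1 hi,
      (matExponent_ne_zero_iff h (A l) τ _).2 ⟨i, j, rfl, hij⟩⟩

/-- A smaller cover shrinks some column. Restoring all other columns keeps it a cover, so testing
single-column changes, that is `shift`, is enough. -/
theorem minimal_isVertexCover_chainIdeal_iff (A : Fin s → Matrix (Fin c) (Fin m) (Fin 2))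
    (h : m ≤ n) (S : Finset (Fin c × Fin n)) :
    Minimal (fun T : Finset (Fin c × Fin n) =>
      IsVertexCover (chainIdeal k A n) (T : Set (Fin c × Fin n))) S ↔
      IsMinimalCoverType A (colCount (cols S)) := by
  have hmono : ∀ {T T' : Finset (Fin c × Fin n)}, T ⊆ T' →
      IsCoverType A (colCount (cols T)) → IsCoverType A (colCount (cols T')) := by
    intro T T' hT hc
    rw [← isVertexCover_chainIdeal_iff (k := k) A h] at hc ⊢
    exact hc.trans (Ideal.span_mono (Set.image_mono (by exact_mod_cast hT)))
  simp only [Minimal, isVertexCover_chainIdeal_iff A h]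
  refine and_congr_right fun _ => ⟨fun hmin U V hVU hU hcov => ?_, fun hmin T hT hTS => ?_⟩
  · obtain ⟨j, hj⟩ := Finset.card_pos.1 hU
    obtain rfl : cols S j = U := (Finset.mem_filter.1 hj).2
    rw [← colCount_update _ _ hVU.ne, ← cols_ofCols (Function.update (cols S) j V)] at hcov
    have hsub : ofCols (Function.update (cols S) j V) ⊆ S := by
      rw [subset_iff_cols_subset, cols_ofCols]
      intro j'
      by_cases hj' : j' = j
      · subst hj'
        simpa using hVU.subset
      · simp [hj']
    have := subset_iff_cols_subset.1 (hmin hcov hsub) j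
    rw [cols_ofCols, Function.update_self] at this
    exact hVU.2 this
  · rw [subset_iff_cols_subset]
    intro j
    by_contra hj
    have hss : cols T j ⊂ cols S j := ⟨subset_iff_cols_subset.1 hTS j, hj⟩
    refine hmin _ _ hss (Finset.card_pos.2 ⟨j, by simp⟩) ?_
    rw [← colCount_update _ _ hss.ne, ← cols_ofCols (Function.update (cols S) j (cols T j))]
    refine hmono ?_ hT
    rw [subset_iff_cols_subset, cols_ofCols]
    intro j'
    by_cases hj' : j' = j
    · subst hj'
      simp
    · simpa [hj'] using subset_iff_cols_subset.1 hTS j'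

theorem dualGens_eq (A : Fin s → Matrix (Fin c) (Fin m) (Fin 2)) (h : m ≤ n) :
    dualGens k A n = (fun S : Finset (Fin c × Fin n) => (∏ v ∈ S, X v : PolyRing k c n)) ''
      {S | IsMinimalCoverType A (colCount (cols S))} := by
  simp only [← minimal_isVertexCover_chainIdeal_iff (k := k) A h]
  rw [dualGens, chainIdeal_eq_span A h, minGens_alexanderDual]

theorem totalDegree_image_dualGens (A : Fin s → Matrix (Fin c) (Fin m) (Fin 2)) (h : m ≤ n) :
    totalDegree '' dualGens k A n =
      (fun N : Finset (Fin c) → ℕ => ∑ U, U.card * N U) ''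
        {N | ∑ U, N U = n ∧ IsMinimalCoverType A N} := by
  rw [dualGens_eq A h, Set.image_image]
  ext d
  constructor
  · rintro ⟨S, hS, rfl⟩
    exact ⟨_, ⟨sum_colCount _, hS⟩, by simp only [totalDegree_prod_X, card_eq_sum_colCount]⟩
  · rintro ⟨N, ⟨hN, hmin⟩, rfl⟩
    obtain ⟨T, rfl⟩ := exists_colCount_eq hN
    refine ⟨ofCols T, ?_, by
      simp only [totalDegree_prod_X, card_eq_sum_colCount, cols_ofCols]⟩
    change IsMinimalCoverType A (colCount (cols (ofCols T)))
    rwa [cols_ofCols]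

theorem dualGens_totalDegree_eq (A : Fin s → Matrix (Fin c) (Fin m) (Fin 2)) (h : m ≤ n)
    (d : ℕ) :
    {f ∈ dualGens k A n | f.totalDegree = d} =
      (fun S : Finset (Fin c × Fin n) => (∏ v ∈ S, X v : PolyRing k c n)) ''
        {S | IsMinimalCoverType A (colCount (cols S)) ∧
          ∑ U, U.card * colCount (cols S) U = d} := by
  rw [dualGens_eq A h]
  ext f
  constructor
  · rintro ⟨⟨S, hS, rfl⟩, hd⟩
    exact ⟨S, ⟨hS, by rw [← card_eq_sum_colCount, ← hd, totalDegree_prod_X]⟩, rfl⟩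
  · rintro ⟨S, ⟨hS, hd⟩, rfl⟩
    exact ⟨⟨S, hS, rfl⟩, by rw [totalDegree_prod_X, card_eq_sum_colCount, hd]⟩

end Chain

end SymDual

/-! ### Assembly of the two statements -/

theorem mainTheorem1 {k : Type*} [Field k] {c m s : ℕ} (hc : 0 < c)
    (A : Fin s → Matrix (Fin c) (Fin m) (Fin 2)) :
    (∃ p : Polynomial ℚ, p.natDegree ≤ c.choose (c / 2) - 1 ∧
      ∀ᶠ n : ℕ in atTop,
        (SymDual.numOrbits (SymDual.dualGens k A n) : ℚ) = p.eval (n : ℚ)) ∧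
    ((∀ i, A i ≠ 0) →
      ∃ d : ℕ → ℕ,
        (∃ a b : ℤ, ∀ᶠ n : ℕ in atTop, (d n : ℤ) = a * n + b) ∧
        (∀ᶠ n : ℕ in atTop, IsLeast (totalDegree '' SymDual.dualGens k A n) (d n)) ∧
        ∃ q : Polynomial ℚ, ∀ᶠ n : ℕ in atTop,
          (SymDual.numOrbits {f ∈ SymDual.dualGens k A n | f.totalDegree = d n} : ℚ) =
            q.eval (n : ℚ)) := by
  constructor
  · obtain ⟨p, hd, hp⟩ := SymDual.exists_polynomial_ncard
      (SymDual.isMinimalCoverType_truncate_iff (A := A)) fun N hN => hN.card_saturated_le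
    refine ⟨p, hd, ?_⟩
    filter_upwards [hp, eventually_ge_atTop m] with n hn hmn
    rw [SymDual.dualGens_eq A hmn, SymDual.numOrbits_prod_X, hn]
  · intro hA
    obtain ⟨d, hlin, hleast, q, hq⟩ := SymDual.exists_least_weight Finset.card
      (SymDual.isMinimalCoverType_truncate_iff (A := A)) (SymDual.exists_isMinimalCoverType hA)
    refine ⟨d, hlin, ?_, q, ?_⟩
    · filter_upwards [hleast, eventually_ge_atTop m] with n hn hmn
      rwa [SymDual.totalDegree_image_dualGens A hmn]
    · filter_upwards [hq, eventually_ge_atTop m] with n hn hmn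
      -- The degree condition too depends only on the multiplicities, so the same orbit count
      -- applies.
      rw [SymDual.dualGens_totalDegree_eq A hmn, SymDual.numOrbits_prod_X
        (fun N => SymDual.IsMinimalCoverType A N ∧ ∑ U, U.card * N U = d n), ← hn]
      simp only [and_assoc]
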